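/- Let $\mathbb T$ be the unit circle with normalized Lebesgue measure $\boldsymbol m$, and let $w$ be a $C^\infty$ function on $\mathbb R$ with $w\ge 0$, $\operatorname{supp} w\subset[\frac12,2]$ and $\sum_{n\in\mathbb Z}w(2^nx)=1$ for all $x>0$. Put $$W_0(z)=\bar z+1+z,\qquad W_n(z)=\sum_{k\in\mathbb Z}w\Big(\frac{k}{2^n}\Big)z^k\ (n\ge1),\qquad W_n^\#(z)=\overline{W_n(z)},$$ and $(\varphi*W)(z)=\int_{\mathbb T}\varphi(\zeta)W(z\bar\zeta)\,d\boldsymbol m(\zeta)$. For a positive integer $m$, the Besov class $B^m_{\infty1}(\mathbb T)$ consists of the functions $\varphi\in L^1(\mathbb T)$ (identified when equal almost everywhere) such that $$\sum_{n\ge0}2^{nm}\|\varphi*W_n\|_{L^\infty}<\infty\quad\text{and}\quad\sum_{n\ge1}2^{nm}\|\varphi*W_n^\#\|_{L^\infty}<\infty .$$ The divided differences of a function $\varphi$ on $\mathbb T$ are defined by $\mathfrak D^0\varphi=\varphi$ and, for $k\ge1$, $$(\mathfrak D^k\varphi)(\lambda_1,\dots,\lambda_{k+1})=\frac{(\mathfrak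 D^{k-1}\varphi)(\lambda_1,\dots,\lambda_k)-(\mathfrak D^{k-1}\varphi)(\lambda_2,\dots,\lambda_{k+1})}{\lambda_1-\lambda_{k+1}},\qquad \lambda_1\neq\lambda_{k+1},$$ extended to the points with $\lambda_1=\lambda_{k+1}$ by continuity (as the limit of the quotient along points with $\lambda_1\ne\lambda_{k+1}$). Theorem. Let $m$ be a positive integer and let $\varphi\in B^m_{\infty1}(\mathbb T)$. Then $\varphi$ coincides almost everywhere with a continuous function, and, for this continuous representative (again denoted $\varphi$), the $m$-th divided difference belongs to the projective tensor product of $m+1$ copies of $C(\mathbb T)$, $$\mathfrak D^m\varphi\in\underbrace{C(\mathbb T)\hat\otimes\cdots\hat\otimes C(\mathbb T)}_{m+1};$$ that is, there are functions $f_{n,j}\in C(\mathbb T)$, $n\ge0$, $1\le j\le m+1$, with $$\sum_{n\ge0}\|f_{n,1}\|_\infty\cdots\|f_{n,m+1}\|_\infty<\infty\quad\text{and}\quad(\mathfrak D^m\varphi)(\lambda_1,\dots,\lambda_{m+1})=\sum_{n\ge0}f_{n,1}(\lambda_1)\cdots f_{n,m+1}(\lambda_{m+1})$$ for all $\lambda_1,\dots,\lambda_{m+1}\in\mathbb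 T$. -/

import Mathlib

open MeasureTheory Filter Topology
open scoped ENNReal ContDiff ComplexConjugate

/-- A smooth dyadic resolution of unity on the half-line `(0, ∞)`: `w` is `C^∞` on `ℝ`, `w ≥ 0`,
`supp w ⊆ [1/2, 2]`, and `∑_{n ∈ ℤ} w (2^n x) = 1` for every `x > 0`. -/
structure IsDyadicResolution (w : ℝ → ℝ) : Prop where
  contDiff : ContDiff ℝ ∞ w
  nonneg : ∀ x, 0 ≤ w x
  tsupport_subset : tsupport w ⊆ Set.Icc (1 / 2) 2
  hasSum : ∀ x : ℝ, 0 < x → HasSum (fun n : ℤ => w ((2 : ℝ) ^ n * x)) 1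

/-- The trigonometric polynomials `W_0(z) = z̄ + 1 + z` and `W_n(z) = ∑_{k ∈ ℤ} w(k / 2^n) z^k`
for `n ≥ 1` (a finite sum, because `w` has compact support). -/
noncomputable def besovKernel (w : ℝ → ℝ) : ℕ → Circle → ℂ
  | 0, z => conj (z : ℂ) + 1 + (z : ℂ)
  | n + 1, z => ∑' k : ℤ, (w ((k : ℝ) / 2 ^ (n + 1)) : ℂ) * (z : ℂ) ^ k

/-- The kernels `W_n^#`, the pointwise complex conjugates of `W_n`. -/
noncomputable def besovKernelSharp (w : ℝ → ℝ) (n : ℕ) (z : Circle) : ℂ :=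
  conj (besovKernel w n z)

/-- A function on the unit circle, read in the angular variable `t ∈ ℝ/ℤ`, `z = e^{2πit}`. The
normalized Lebesgue measure of the circle is the Haar probability measure in `t`. -/
noncomputable def onAngle (φ : Circle → ℂ) : UnitAddCircle → ℂ :=
  fun t => φ (AddCircle.toCircle t)

/-- Convolution on the circle with respect to normalized Lebesgue measure:
`(φ * W)(z) = ∫ φ(ζ) W(z ζ⁻¹) dm(ζ)`. -/
noncomputable def circleConv (φ W : Circle → ℂ) (z : Circle) : ℂ :=
  ∫ t : UnitAddCircle,
    φ (AddCircle.toCircle t) * W (z * (AddCircle.toCircle t)⁻¹) ∂AddCircle.haarAddCircle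

/-- The `L^∞` norm, with respect to normalized Lebesgue measure, of a function on the circle. -/
noncomputable def circleLInftyNorm (f : Circle → ℂ) : ℝ≥0∞ :=
  eLpNorm (onAngle f) ∞ AddCircle.haarAddCircle

/-- The function `φ` on the circle belongs to the Besov class `B^d_{∞1}(𝕋)`: it is integrable,
and the sequences `2^{nd} ‖φ * W_n‖_∞` (`n ≥ 0`) and `2^{nd} ‖φ * W_n^#‖_∞` (`n ≥ 1`) are in `ℓ^1`.
Here `W_n`, `W_n^#` are the kernels built from `w`. -/
structure MemBesovInftyOne (w : ℝ → ℝ) (d : ℕ) (φ : Circle → ℂ) : Prop where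
  integrable : Integrable (onAngle φ) AddCircle.haarAddCircle
  sum_lt_top : ∑' n : ℕ, (2 : ℝ≥0∞) ^ (n * d) *
    circleLInftyNorm (circleConv φ (besovKernel w n)) < ⊤
  sum_sharp_lt_top : ∑' n : ℕ, (2 : ℝ≥0∞) ^ ((n + 1) * d) *
    circleLInftyNorm (circleConv φ (besovKernelSharp w (n + 1))) < ⊤

/-- The divided differences `𝔇^k φ` of a function on the unit circle, as functions on `𝕋^{k+1}`:
`𝔇^0 φ = φ` and
`𝔇^{k+1} φ (λ_1, …, λ_{k+2}) =
  (𝔇^k φ (λ_1, …, λ_{k+1}) - 𝔇^k φ (λ_2, …, λ_{k+2})) / (λ_1 - λ_{k+2})`,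
where on the set `λ_1 = λ_{k+2}` the quotient is extended by continuity, i.e. replaced by its limit
along the points with distinct first and last coordinates. -/
noncomputable def dividedDiff (φ : Circle → ℂ) : (k : ℕ) → (Fin (k + 1) → Circle) → ℂ
  | 0 => fun z => φ (z 0)
  | k + 1 =>
    let q : (Fin (k + 2) → Circle) → ℂ := fun u =>
      (dividedDiff φ k (Fin.init u) - dividedDiff φ k (Fin.tail u)) /
        ((u 0 : ℂ) - (u (Fin.last (k + 1)) : ℂ))
    fun z =>
      open Classical in
      if z 0 = z (Fin.last (k + 1)) then
        limUnder (𝓝[{u | u 0 ≠ u (Fin.last (k + 1))}] z) q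
      else q z

/-- The function `ψ` on `𝕋^N` belongs to the projective tensor product of `N` copies of `C(𝕋)`:
`ψ(z_1, …, z_N) = ∑_n f_{n,1}(z_1) ⋯ f_{n,N}(z_N)` with `f_{n,j}` continuous and
`∑_n ‖f_{n,1}‖ ⋯ ‖f_{n,N}‖ < ∞`, sup norms. -/
def MemProjTensorCircle {N : ℕ} (ψ : (Fin N → Circle) → ℂ) : Prop :=
  ∃ f : ℕ → Fin N → C(Circle, ℂ),
    Summable (fun n => ∏ j, ‖f n j‖) ∧
    ∀ z : Fin N → Circle, HasSum (fun n => ∏ j, f n j (z j)) (ψ z)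

/-! Split `φ` by frequency: the blocks `φ * W_n` and `φ * W_n^#` (`n ≥ 1`) are polynomials in `z`
and in `z̄` with frequencies of order `2^n`, and frequencies `|k| ≤ 1` are left over. It suffices to
bound the projective norm of `𝔇^m` of a block by a constant times `2^{nm}` times its sup norm; the
Besov condition then sums the bounds.

For a polynomial, `𝔇^k z^s` is the complete homogeneous polynomial `h_{s-k}`, so `𝔇^k p = ∑_j
q_{|j|} ∏ z_i^{j_i}` with `q = divX^[k] p`. Expanding into monomials loses too much. Instead write
`q_s = (s+k+1) h_s`. Since `|j|+k+1 = ∑_i (j_i+1)`, the sum splits into `k+1` pieces; in the `i`-th,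
fix all exponents but `j_i` and sum over `j_i`. The resulting function `∑_j (j+1) h_{j+c} z^j` is a
convolution with the square of a Dirichlet kernel, whose `L^1` norm is only `N+1`
(`norm_sum_succ_mul_coeff_le`). Also `h(z) = ∫_0^1 r^k q(rz) dr`, and the zero of `q` at the origin
makes this smaller than `q` by the factor `1/(M+k+1)` (`exists_integrated_polynomial`). The result
is `hasProjBound_homogeneousSum`; with degree `N` and order of vanishing `M` both of order `2^n`, it
has the required size.

The sum of all pieces has the Fourier coefficients of `φ`, hence is its continuous representative.
-/

/-! ### Bounds for the projective tensor norm -/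

/-- `ψ` is the sum of a countable family of elementary tensors of continuous functions on the
circle, the sum of whose norms is at most `B`. -/
def HasProjBound {N : ℕ} (ψ : (Fin N → Circle) → ℂ) (B : ℝ) : Prop :=
  ∃ (ι : Type) (_ : Countable ι) (f : ι → Fin N → C(Circle, ℂ)),
    Summable (fun i => ∏ j, ‖f i j‖) ∧ ∑' i, ∏ j, ‖f i j‖ ≤ B ∧
    ∀ z : Fin N → Circle, HasSum (fun i => ∏ j, f i j (z j)) (ψ z)

namespace HasProjBound

variable {N : ℕ} {ψ : (Fin N → Circle) → ℂ} {B : ℝ}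

theorem mono (h : HasProjBound ψ B) {B' : ℝ} (hB : B ≤ B') : HasProjBound ψ B' := by
  obtain ⟨ι, hι, f, hs, hb, hf⟩ := h
  exact ⟨ι, hι, f, hs, hb.trans hB, hf⟩

theorem nonneg (h : HasProjBound ψ B) : 0 ≤ B := by
  obtain ⟨ι, hι, f, hs, hb, hf⟩ := h
  exact (tsum_nonneg fun i => Finset.prod_nonneg fun j _ => norm_nonneg _).trans hb

theorem norm_prod_apply_le (f : Fin N → C(Circle, ℂ)) (z : Fin N → Circle) :
    ‖∏ j, f j (z j)‖ ≤ ∏ j, ‖f j‖ := by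
  rw [norm_prod]
  exact Finset.prod_le_prod (fun _ _ => norm_nonneg _) fun j _ => (f j).norm_coe_le_norm _

theorem norm_le (h : HasProjBound ψ B) (z : Fin N → Circle) : ‖ψ z‖ ≤ B := by
  obtain ⟨ι, hι, f, hs, hb, hf⟩ := h
  rw [← (hf z).tsum_eq]
  exact (tsum_of_norm_bounded hs.hasSum fun i => norm_prod_apply_le _ z).trans hb

theorem continuous (h : HasProjBound ψ B) : Continuous ψ := by
  obtain ⟨ι, hι, f, hs, hb, hf⟩ := h
  have : ψ = fun z => ∑' i, ∏ j, f i j (z j) := funext fun z => (hf z).tsum_eq.symm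
  rw [this]
  exact continuous_tsum (fun i => by fun_prop) hs fun i z => norm_prod_apply_le _ z

theorem elementary (f : Fin N → C(Circle, ℂ)) :
    HasProjBound (fun z => ∏ j, f j (z j)) (∏ j, ‖f j‖) :=
  ⟨Unit, inferInstance, fun _ => f, (hasSum_fintype _).summable, by simp,
    fun z => by simp⟩

theorem hasSum {α : Type} [Countable α] {ψ : α → (Fin N → Circle) → ℂ} {B : α → ℝ}
    {Ψ : (Fin N → Circle) → ℂ} (h : ∀ a, HasProjBound (ψ a) (B a)) (hB : Summable B)
    (hΨ : ∀ z, HasSum (fun a => ψ a z) (Ψ z)) : HasProjBound Ψ (∑' a, B a) := by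
  choose ι hι f hs hb hf using h
  have h0 : ∀ a i, 0 ≤ ∏ j, ‖f a i j‖ := fun a i => Finset.prod_nonneg fun j _ => norm_nonneg _
  have hsum : Summable fun a => ∑' i, ∏ j, ‖f a i j‖ :=
    Summable.of_nonneg_of_le (fun a => tsum_nonneg (h0 a)) hb hB
  have hsig : Summable fun i : Σ a, ι a => ∏ j, ‖f i.1 i.2 j‖ :=
    (summable_sigma_of_nonneg fun i => h0 i.1 i.2).2 ⟨hs, hsum⟩
  refine ⟨Σ a, ι a, inferInstance, fun i => f i.1 i.2, hsig, ?_, fun z => ?_⟩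
  · rw [hsig.tsum_sigma]
    exact hsum.tsum_le_tsum hb hB
  · have hz : Summable fun i : Σ a, ι a => ∏ j, f i.1 i.2 j (z j) :=
      Summable.of_norm_bounded hsig fun i => norm_prod_apply_le _ z
    have := hz.hasSum.sigma fun a => hf a z
    rw [← this.unique (hΨ z)]
    exact hz.hasSum

theorem sum {α : Type} [Fintype α] {ψ : α → (Fin N → Circle) → ℂ} {B : α → ℝ}
    (h : ∀ a, HasProjBound (ψ a) (B a)) : HasProjBound (fun z => ∑ a, ψ a z) (∑ a, B a) := by
  rw [← tsum_fintype (L := .unconditional α)]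
  exact hasSum h (hasSum_fintype _).summable fun z => hasSum_fintype _

/-- The index type is embedded in `ℕ` and the family extended by zero. At least one factor is
needed: an empty product would be `1` on the added indices. -/
theorem memProjTensorCircle {ψ : (Fin (N + 1) → Circle) → ℂ} (h : HasProjBound ψ B) :
    MemProjTensorCircle ψ := by
  obtain ⟨ι, hι, f, hs, hb, hf⟩ := h
  obtain ⟨e, he⟩ := exists_injective_nat ι
  have hF : ∀ n ∉ Set.range e, Function.extend e f 0 n = 0 := fun n hn =>
    Function.extend_apply' _ _ _ hn
  refine ⟨Function.extend e f 0, ?_, fun z => ?_⟩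
  · refine (he.summable_iff fun n hn => ?_).1 ?_
    · simp [hF n hn]
    · simpa [Function.comp_def, he.extend_apply] using hs
  · refine (he.hasSum_iff fun n hn => ?_).1 ?_
    · simp [hF n hn]
    · simpa [Function.comp_def, he.extend_apply] using hf z

/-- Used to pass to negative frequencies. Inversion permutes the circle and the new factors are
unimodular, so the bound is unchanged; the scalar `c` is absorbed by coordinate `0`, hence `0 < N`.
-/
theorem comp_inv_mul_prod_conj (h : HasProjBound ψ B) (c : ℂ) (hc : ‖c‖ = 1) (hN : 0 < N) :
    HasProjBound (fun z => c * (∏ j, conj (z j : ℂ)) * ψ (fun j => (z j)⁻¹)) B := by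
  obtain ⟨ι, hι, f, hs, hb, hf⟩ := h
  obtain ⟨N, rfl⟩ := Nat.exists_eq_succ_of_ne_zero hN.ne'
  let d : Fin (N + 1) → ℂ := Fin.cons c fun _ => 1
  have hd : ∀ j, ‖d j‖ = 1 := by
    intro j; refine Fin.cases ?_ (fun j => ?_) j <;> simp [d, hc]
  have hdp : ∏ j, d j = c := by simp [d, Fin.prod_univ_succ]
  let F : ι → Fin (N + 1) → C(Circle, ℂ) := fun i j =>
    ⟨fun x => d j * conj (x : ℂ) * f i j x⁻¹, by fun_prop⟩
  have hF : ∀ i j, ‖F i j‖ ≤ ‖f i j‖ := fun i j => by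
    refine (ContinuousMap.norm_le _ (norm_nonneg _)).2 fun x => ?_
    simpa only [F, ContinuousMap.coe_mk, norm_mul, hd, RCLike.norm_conj, Circle.norm_coe, one_mul]
      using (f i j).norm_coe_le_norm x⁻¹
  have hF' : ∀ i, ∏ j, ‖F i j‖ ≤ ∏ j, ‖f i j‖ := fun i =>
    Finset.prod_le_prod (fun _ _ => norm_nonneg _) fun j _ => hF i j
  have hs' := Summable.of_nonneg_of_le
    (fun i => Finset.prod_nonneg fun j _ => norm_nonneg (F i j)) hF' hs
  refine ⟨ι, hι, F, hs', (hs'.tsum_le_tsum hF' hs).trans hb, fun z => ?_⟩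
  have := (hf fun j => (z j)⁻¹).mul_left (c * ∏ j, conj (z j : ℂ))
  simpa [F, Finset.prod_mul_distrib, hdp] using this

end HasProjBound

/-! ### Divided differences through their recurrence -/

/-- There are functions `E k`, `k ≤ m`, with projective tensor norm at most `B`, which satisfy the
recurrence of the divided differences of `g`. -/
def HasProjDividedDiffs (m : ℕ) (g : Circle → ℂ) (B : ℝ) : Prop :=
  ∃ E : (k : ℕ) → (Fin (k + 1) → Circle) → ℂ,
    (∀ k ≤ m, HasProjBound (E k) B) ∧ (∀ z, E 0 z = g (z 0)) ∧
    ∀ k < m, ∀ z : Fin (k + 2) → Circle,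
      ((z 0 : ℂ) - z (Fin.last (k + 1))) * E (k + 1) z = E k (Fin.init z) - E k (Fin.tail z)

theorem Circle.neBot_nhdsNE (a : Circle) : (𝓝[≠] a).NeBot := by
  have hc : Tendsto (fun t : ℝ => a * Circle.exp t) (𝓝[≠] 0) (𝓝[≠] a) := by
    refine tendsto_nhdsWithin_iff.2 ⟨?_, ?_⟩
    · have : Continuous fun t : ℝ => a * Circle.exp t := by fun_prop
      simpa using (this.tendsto 0).mono_left nhdsWithin_le_nhds
    · have h1 : Set.Ioo (-1 : ℝ) 1 ∈ 𝓝[≠] (0 : ℝ) :=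
        mem_nhdsWithin_of_mem_nhds (Ioo_mem_nhds (by norm_num) (by norm_num))
      filter_upwards [h1, self_mem_nhdsWithin] with t ht ht0 h
      have h2 : Circle.exp t = Circle.exp 0 := by simpa using h
      have h3 := congrArg (fun u : Circle => Complex.arg u) h2
      have hpi := Real.pi_gt_three
      simp only [Circle.arg_exp (x := t) (by linarith [ht.1]) (by linarith [ht.2]),
        Circle.arg_exp (x := 0) (by linarith) (by linarith)] at h3
      exact ht0 h3
  exact hc.neBot

theorem neBot_nhdsWithin_ne {n : ℕ} {i j : Fin n} (hij : i ≠ j) (z : Fin n → Circle)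
    (hz : z i = z j) : (𝓝[{u | u i ≠ u j}] z).NeBot := by
  have := Circle.neBot_nhdsNE (z i)
  have hc : Tendsto (fun a => Function.update z i a) (𝓝[≠] (z i)) (𝓝[{u | u i ≠ u j}] z) := by
    refine tendsto_nhdsWithin_iff.2 ⟨?_, ?_⟩
    · have : Continuous fun a => Function.update z i a := by fun_prop
      simpa using (this.tendsto (z i)).mono_left nhdsWithin_le_nhds
    · filter_upwards [self_mem_nhdsWithin] with a ha
      simpa [Function.update_of_ne hij.symm, ← hz] using ha
  exact hc.neBot

namespace HasProjDividedDiffs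

variable {m : ℕ} {g : Circle → ℂ} {B : ℝ}

theorem mono (h : HasProjDividedDiffs m g B) {B' : ℝ} (hB : B ≤ B') :
    HasProjDividedDiffs m g B' := by
  obtain ⟨E, hE, h0, hr⟩ := h
  exact ⟨E, fun k hk => (hE k hk).mono hB, h0, hr⟩

theorem nonneg (h : HasProjDividedDiffs m g B) : 0 ≤ B := by
  obtain ⟨E, hE, h0, hr⟩ := h
  exact (hE 0 m.zero_le).nonneg

theorem norm_le (h : HasProjDividedDiffs m g B) (z : Circle) : ‖g z‖ ≤ B := by
  obtain ⟨E, hE, h0, hr⟩ := h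
  simpa [h0] using (hE 0 m.zero_le).norm_le fun _ => z

theorem continuous (h : HasProjDividedDiffs m g B) : Continuous g := by
  obtain ⟨E, hE, h0, hr⟩ := h
  have : g = fun z => E 0 fun _ => z := by simp [h0]
  rw [this]
  exact (hE 0 m.zero_le).continuous.comp (by fun_prop)

/-- The recurrence is linear, and `B` is a summable majorant at every level `k ≤ m` at once, so it
survives termwise summation. -/
theorem hasSum {α : Type} [Countable α] {g : α → Circle → ℂ} {B : α → ℝ} {G : Circle → ℂ}
    (h : ∀ a, HasProjDividedDiffs m (g a) (B a)) (hB : Summable B)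
    (hG : ∀ z, HasSum (fun a => g a z) (G z)) : HasProjDividedDiffs m G (∑' a, B a) := by
  choose E hE h0 hr using h
  have hs : ∀ k ≤ m, ∀ z, HasSum (fun a => E a k z) (∑' a, E a k z) := fun k hk z =>
    (Summable.of_norm_bounded hB fun a => (hE a k hk).norm_le z).hasSum
  refine ⟨fun k z => ∑' a, E a k z, fun k hk => .hasSum (fun a => hE a k hk) hB (hs k hk),
    fun z => ?_, fun k hk z => ?_⟩
  · simp only [h0]
    exact (hG _).tsum_eq
  · have h1 := (hs k hk.le (Fin.init z)).sub (hs k hk.le (Fin.tail z))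
    have h2 := (hs (k + 1) hk z).mul_left ((z 0 : ℂ) - z (Fin.last (k + 1)))
    refine h2.unique ?_
    simpa only [hr _ k hk] using h1

theorem add {g₁ g₂ : Circle → ℂ} {B₁ B₂ : ℝ} (h₁ : HasProjDividedDiffs m g₁ B₁)
    (h₂ : HasProjDividedDiffs m g₂ B₂) : HasProjDividedDiffs m (fun z => g₁ z + g₂ z) (B₁ + B₂) := by
  have := hasSum (α := Bool) (g := fun b => cond b g₁ g₂) (B := fun b => cond b B₁ B₂)
    (G := fun z => g₁ z + g₂ z) (m := m) (by rintro (_ | _) <;> assumption)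
    (hasSum_fintype _).summable fun z => by
      simpa using hasSum_fintype fun b : Bool => cond b g₁ g₂ z
  simpa using this

/-- Off the set `z 0 = z (Fin.last _)` the recurrence determines the next level. Every point of that
set is a limit of points outside it, since the circle has no isolated points, so continuity of `E`
evaluates `limUnder`. -/
theorem dividedDiff_eq {E : (k : ℕ) → (Fin (k + 1) → Circle) → ℂ}
    (hE : ∀ k ≤ m, Continuous (E k)) (h0 : ∀ z, E 0 z = g (z 0))
    (hr : ∀ k < m, ∀ z : Fin (k + 2) → Circle,
      ((z 0 : ℂ) - z (Fin.last (k + 1))) * E (k + 1) z = E k (Fin.init z) - E k (Fin.tail z)) :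
    ∀ k ≤ m, dividedDiff g k = E k := by
  intro k
  induction k with
  | zero => intro _; funext z; simp [dividedDiff, h0]
  | succ k ih =>
    intro hk
    have ih := ih (by omega)
    have hq : ∀ u : Fin (k + 2) → Circle, u 0 ≠ u (Fin.last (k + 1)) →
        (dividedDiff g k (Fin.init u) - dividedDiff g k (Fin.tail u)) /
          ((u 0 : ℂ) - (u (Fin.last (k + 1)) : ℂ)) = E (k + 1) u := fun u hu => by
      have : (u 0 : ℂ) - u (Fin.last (k + 1)) ≠ 0 :=
        sub_ne_zero.2 fun h => hu (Circle.ext h)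
      rw [ih, ← hr k hk u]
      field_simp
    funext z
    rw [dividedDiff]
    beta_reduce
    split_ifs with hz
    · have hne : (0 : Fin (k + 2)) ≠ Fin.last (k + 1) := by simp [Fin.ext_iff]
      have := neBot_nhdsWithin_ne hne z hz
      refine Tendsto.limUnder_eq ?_
      refine (((hE _ hk).tendsto z).mono_left nhdsWithin_le_nhds).congr' ?_
      filter_upwards [self_mem_nhdsWithin] with u hu
      exact (hq u hu).symm
    · exact hq z hz

theorem memProjTensorCircle (h : HasProjDividedDiffs m g B) :
    MemProjTensorCircle (dividedDiff g m) := by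
  obtain ⟨E, hE, h0, hr⟩ := h
  rw [dividedDiff_eq (fun k hk => (hE k hk).continuous) h0 hr m le_rfl]
  exact (hE m le_rfl).memProjTensorCircle

end HasProjDividedDiffs

/-! ### Complete homogeneous polynomials and divided differences of monomials -/

/-- The complete homogeneous symmetric polynomial of degree `s`, as a coefficient of
`∏ i, 1 / (1 - x i X)`. -/
noncomputable def completeHomogeneous {n : ℕ} (x : Fin n → ℂ) (s : ℕ) : ℂ :=
  PowerSeries.coeff s (∏ i, PowerSeries.mk fun a => x i ^ a)

theorem one_sub_mul_mk_pow (x : ℂ) :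
    (1 - PowerSeries.C x * PowerSeries.X) * PowerSeries.mk (fun a => x ^ a) = 1 := by
  ext n
  cases n with
  | zero => simp
  | succ n =>
    rw [sub_mul, one_mul, mul_assoc, map_sub, PowerSeries.coeff_C_mul,
      PowerSeries.coeff_succ_X_mul]
    simp [pow_succ', PowerSeries.coeff_one]

theorem completeHomogeneous_zero {n : ℕ} (x : Fin n → ℂ) : completeHomogeneous x 0 = 1 := by
  simp [completeHomogeneous, map_prod,
    ← PowerSeries.coeff_zero_eq_constantCoeff_apply]

theorem coeff_succ_one_sub_mul (x : ℂ) (F : PowerSeries ℂ) (s : ℕ) :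
    PowerSeries.coeff (s + 1) ((1 - PowerSeries.C x * PowerSeries.X) * F) =
      PowerSeries.coeff (s + 1) F - x * PowerSeries.coeff s F := by
  rw [sub_mul, one_mul, mul_assoc, map_sub, PowerSeries.coeff_C_mul, PowerSeries.coeff_succ_X_mul]

/-- Deleting the variable `x 0` multiplies the generating function by `1 - x 0 * X`. -/
theorem completeHomogeneous_tail_succ {n : ℕ} (x : Fin (n + 1) → ℂ) (s : ℕ) :
    completeHomogeneous (Fin.tail x) (s + 1) =
      completeHomogeneous x (s + 1) - x 0 * completeHomogeneous x s := by
  unfold completeHomogeneous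
  rw [← coeff_succ_one_sub_mul, Fin.prod_univ_succ, ← mul_assoc, one_sub_mul_mk_pow, one_mul]
  rfl

theorem completeHomogeneous_init_succ {n : ℕ} (x : Fin (n + 1) → ℂ) (s : ℕ) :
    completeHomogeneous (Fin.init x) (s + 1) =
      completeHomogeneous x (s + 1) - x (Fin.last n) * completeHomogeneous x s := by
  unfold completeHomogeneous
  rw [← coeff_succ_one_sub_mul, Fin.prod_univ_castSucc, mul_left_comm, one_sub_mul_mk_pow, mul_one]
  rfl

theorem completeHomogeneous_eq_sum {n N : ℕ} (x : Fin n → ℂ) {s : ℕ} (hs : s ≤ N) :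
    completeHomogeneous x s =
      ∑ j : Fin n → Fin (N + 1), if ∑ i, (j i : ℕ) = s then ∏ i, x i ^ (j i : ℕ) else 0 := by
  classical
  unfold completeHomogeneous
  rw [PowerSeries.coeff_prod, ← Finset.sum_filter]
  have hle : ∀ l ∈ Finset.finsuppAntidiag (Finset.univ : Finset (Fin n)) s, ∀ i, l i < N + 1 :=
    fun l hl i => by
      have h1 := (Finset.mem_finsuppAntidiag.1 hl).1
      have h2 : l i ≤ Finset.univ.sum l :=
        Finset.single_le_sum (f := l) (fun _ _ => Nat.zero_le _) (Finset.mem_univ i)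
      change Finset.univ.sum l = s at h1
      omega
  refine Finset.sum_bij' (fun l hl i => ⟨l i, hle l hl i⟩)
    (fun j _ => Finsupp.equivFunOnFinite.symm fun i => (j i : ℕ)) ?_ ?_ ?_ ?_ ?_
  · intro l hl
    simpa using (Finset.mem_finsuppAntidiag.1 hl).1
  · intro j hj
    simpa [Finset.mem_finsuppAntidiag] using hj
  · intro l hl
    ext i; simp
  · intro j hj
    ext i; simp
  · intro l hl
    simp

open Polynomial

/-- The linear extension of `X ^ s ↦ h_s(x)`, `h_s` being the complete homogeneous symmetric
polynomial. -/
noncomputable def homogeneousSum {n : ℕ} (p : ℂ[X]) (x : Fin n → ℂ) : ℂ :=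
  p.sum fun s a => a * completeHomogeneous x s

theorem homogeneousSum_eq_sum_range {n N : ℕ} {p : ℂ[X]} (hp : p.natDegree ≤ N) (x : Fin n → ℂ) :
    homogeneousSum p x = ∑ s ∈ Finset.range (N + 1), p.coeff s * completeHomogeneous x s :=
  p.sum_over_range' (f := fun s a => a * completeHomogeneous x s) (fun _ => zero_mul _) _
    (Nat.lt_succ_of_le hp)

theorem natDegree_divX_le (p : ℂ[X]) : p.divX.natDegree ≤ p.natDegree := by
  rw [natDegree_divX_eq_natDegree_tsub_one]; omega

/-- Subtracted from `homogeneousSum_init`, this gives the divided difference recurrence: the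
difference is `(x 0 - x (Fin.last n)) * homogeneousSum p.divX x`. -/
theorem homogeneousSum_tail {n : ℕ} (p : ℂ[X]) (x : Fin (n + 1) → ℂ) :
    homogeneousSum p (Fin.tail x) = homogeneousSum p x - x 0 * homogeneousSum p.divX x := by
  -- The sums for `p` run one index further than needed, so that after the term `s = 0` is split off
  -- they match the range used for `divX`.
  rw [homogeneousSum_eq_sum_range (Nat.le_succ p.natDegree),
    homogeneousSum_eq_sum_range (Nat.le_succ p.natDegree),
    homogeneousSum_eq_sum_range (natDegree_divX_le p),
    Finset.sum_range_succ', Finset.sum_range_succ' _ (p.natDegree + 1), Finset.mul_sum]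
  simp only [completeHomogeneous_zero, completeHomogeneous_tail_succ, coeff_divX, mul_sub,
    Finset.sum_sub_distrib]
  simp only [mul_left_comm (x 0)]
  ring

theorem homogeneousSum_init {n : ℕ} (p : ℂ[X]) (x : Fin (n + 1) → ℂ) :
    homogeneousSum p (Fin.init x) =
      homogeneousSum p x - x (Fin.last n) * homogeneousSum p.divX x := by
  rw [homogeneousSum_eq_sum_range (Nat.le_succ p.natDegree),
    homogeneousSum_eq_sum_range (Nat.le_succ p.natDegree),
    homogeneousSum_eq_sum_range (natDegree_divX_le p),
    Finset.sum_range_succ', Finset.sum_range_succ' _ (p.natDegree + 1), Finset.mul_sum]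
  simp only [completeHomogeneous_zero, completeHomogeneous_init_succ, coeff_divX, mul_sub,
    Finset.sum_sub_distrib]
  simp only [mul_left_comm (x (Fin.last n))]
  ring

theorem homogeneousSum_fin_one (p : ℂ[X]) (x : Fin 1 → ℂ) :
    homogeneousSum p x = p.eval (x 0) := by
  simp [homogeneousSum, completeHomogeneous, eval_eq_sum]

theorem homogeneousSum_eq_sum {n N : ℕ} {p : ℂ[X]} (hp : p.natDegree ≤ N) (x : Fin n → ℂ) :
    homogeneousSum p x =
      ∑ j : Fin n → Fin (N + 1), p.coeff (∑ i, (j i : ℕ)) * ∏ i, x i ^ (j i : ℕ) := by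
  rw [homogeneousSum_eq_sum_range hp]
  have : ∀ s ∈ Finset.range (N + 1), p.coeff s * completeHomogeneous x s =
      ∑ j : Fin n → Fin (N + 1), if ∑ i, (j i : ℕ) = s then
        p.coeff (∑ i, (j i : ℕ)) * ∏ i, x i ^ (j i : ℕ) else 0 := fun s hs => by
    rw [completeHomogeneous_eq_sum x (Nat.lt_succ_iff.1 (Finset.mem_range.1 hs)), Finset.mul_sum]
    refine Finset.sum_congr rfl fun j _ => ?_
    split_ifs with h
    · rw [h]
    · simp
  rw [Finset.sum_congr rfl this, Finset.sum_comm]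
  refine Finset.sum_congr rfl fun j _ => ?_
  rw [Finset.sum_ite_eq]
  split_ifs with h
  · rfl
  · rw [coeff_eq_zero_of_natDegree_lt (by simp at h; omega), zero_mul]

/-! ### Sup norm estimates for polynomials on the circle -/

theorem Continuous.integrable_haarAddCircle {f : UnitAddCircle → ℂ} (hf : Continuous f) :
    Integrable f AddCircle.haarAddCircle :=
  hf.integrable_of_hasCompactSupport (HasCompactSupport.of_compactSpace _)

@[fun_prop]
theorem continuous_coe_toCircle :
    Continuous fun t : UnitAddCircle => (AddCircle.toCircle t : ℂ) :=
  continuous_subtype_val.comp AddCircle.continuous_toCircle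

theorem integral_toCircle_zpow (n : ℤ) :
    ∫ t : UnitAddCircle, (AddCircle.toCircle t : ℂ) ^ n ∂AddCircle.haarAddCircle =
      if n = 0 then 1 else 0 := by
  have h := congrFun (fourierCoeff_fourier (T := 1) n) 0
  simp only [fourierCoeff, neg_zero, fourier_zero, one_smul] at h
  have h2 : ∀ t : UnitAddCircle, (AddCircle.toCircle t : ℂ) ^ n = fourier n t := fun t => by
    simp [fourier_apply, AddCircle.toCircle_zsmul]
  simp only [h2, h]
  simp [Pi.single_apply, eq_comm]

theorem integral_eval_mul_conj_pow (q : ℂ[X]) (z : ℂ) (n : ℕ) :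
    ∫ t : UnitAddCircle, q.eval (z * AddCircle.toCircle t) * conj (AddCircle.toCircle t : ℂ) ^ n
      ∂AddCircle.haarAddCircle = q.coeff n * z ^ n := by
  have h : ∀ t : UnitAddCircle,
      q.eval (z * AddCircle.toCircle t) * conj (AddCircle.toCircle t : ℂ) ^ n =
      ∑ s ∈ Finset.range (max q.natDegree n + 1), q.coeff s * z ^ s *
        (AddCircle.toCircle t : ℂ) ^ ((s : ℤ) - n) := fun t => by
    rw [eval_eq_sum_range' (n := max q.natDegree n + 1) (by omega), Finset.sum_mul]
    refine Finset.sum_congr rfl fun s _ => ?_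
    rw [zpow_sub₀ (Circle.coe_ne_zero _), ← Circle.coe_inv_eq_conj, Circle.coe_inv, mul_pow,
      zpow_natCast, zpow_natCast, inv_pow]
    ring
  simp only [h]
  rw [integral_finsetSum]
  · simp only [integral_const_mul, integral_toCircle_zpow, sub_eq_zero, Nat.cast_inj, mul_ite,
      mul_one, mul_zero]
    rw [Finset.sum_ite_eq', if_pos (by simp)]
  · intro s _
    refine Continuous.integrable_haarAddCircle (continuous_const.mul ?_)
    exact continuous_coe_toCircle.zpow₀ _ fun t => Or.inl (Circle.coe_ne_zero _)

/-- There are `j + 1` pairs with `a + b = j`. For `j > N` the square cuts off some of them, but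
there `F` vanishes. -/
theorem sum_range_sum_range_add {F : ℕ → ℂ} {N : ℕ} (hF : ∀ j, N < j → F j = 0) :
    ∑ a ∈ Finset.range (N + 1), ∑ b ∈ Finset.range (N + 1), F (a + b) =
      ∑ j ∈ Finset.range (N + 1), ((j : ℂ) + 1) * F j := by
  have h : ∀ j ∈ Finset.range (N + 1), ((j : ℂ) + 1) * F j =
      ∑ a ∈ Finset.range (N + 1), ∑ b ∈ Finset.range (N + 1),
        if a + b = j then F (a + b) else 0 := fun j hj => by
    have hj' : j ≤ N := Nat.lt_succ_iff.1 (Finset.mem_range.1 hj)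
    have : ((j : ℂ) + 1) * F j = ∑ x ∈ Finset.HasAntidiagonal.antidiagonal j, F (x.1 + x.2) := by
      rw [Finset.sum_congr rfl (g := fun _ => F j) fun x hx => by
        rw [Finset.HasAntidiagonal.mem_antidiagonal.1 hx]]
      simp
    rw [this, ← Finset.sum_product', ← Finset.sum_filter]
    refine Finset.sum_congr ?_ fun _ _ => rfl
    ext x
    simp only [Finset.HasAntidiagonal.mem_antidiagonal, Finset.mem_filter, Finset.mem_product, Finset.mem_range]
    omega
  rw [Finset.sum_congr rfl h]
  symm
  rw [Finset.sum_comm]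
  refine Finset.sum_congr rfl fun a _ => ?_
  rw [Finset.sum_comm]
  refine Finset.sum_congr rfl fun b _ => ?_
  rw [Finset.sum_ite_eq]
  split_ifs with hab
  · rfl
  · exact (hF _ (by simp at hab; omega)).symm

/-- The weights `j + 1`, `j ≤ N`, are the first coefficients of the square of the Dirichlet kernel
`D`; the later ones meet vanishing coefficients of `q`. So the sum is, up to a unimodular factor, an
integral of `q` against `D ^ 2`, and the `L^1` norm of `D ^ 2` is the squared `L^2` norm of `D`,
namely `N + 1`. -/
theorem norm_sum_succ_mul_coeff_le {q : ℂ[X]} {N : ℕ} (hq : q.natDegree ≤ N) {S : ℝ}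
    (hS : ∀ z : Circle, ‖q.eval (z : ℂ)‖ ≤ S) (c : ℕ) (z : Circle) :
    ‖∑ j ∈ Finset.range (N + 1), ((j : ℂ) + 1) * (q.coeff (j + c) * (z : ℂ) ^ j)‖ ≤
      (N + 1) * S := by
  let e : UnitAddCircle → ℂ := fun t => AddCircle.toCircle t
  have he : Continuous e := continuous_coe_toCircle
  let D : UnitAddCircle → ℂ := fun t => ∑ a ∈ Finset.range (N + 1), conj (e t) ^ a
  have hD : Continuous D := by fun_prop
  -- Parseval: `D` has `N + 1` coefficients equal to `1`.
  have hsq : ∫ t, ‖D t‖ ^ 2 ∂AddCircle.haarAddCircle = N + 1 := by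
    have h1 : ∀ t, ((‖D t‖ ^ 2 : ℝ) : ℂ) = ∑ a ∈ Finset.range (N + 1),
        (∑ b ∈ Finset.range (N + 1), (X : ℂ[X]) ^ b).eval (1 * e t) * conj (e t) ^ a := fun t => by
      rw [← Finset.mul_sum]
      push_cast
      rw [← Complex.conj_mul']
      simp [D, eval_finsetSum]
    have h2 : ((∫ t, ‖D t‖ ^ 2 ∂AddCircle.haarAddCircle : ℝ) : ℂ) = N + 1 := by
      rw [← integral_complex_ofReal]
      simp only [h1]
      rw [integral_finsetSum]
      · simp only [e, integral_eval_mul_conj_pow, one_pow, mul_one, finsetSum_coeff, coeff_X_pow]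
        rw [Finset.sum_congr rfl (g := fun _ => (1 : ℂ)) fun a ha => by
          rw [Finset.sum_ite_eq, if_pos ha]]
        simp
      · intro a _
        exact Continuous.integrable_haarAddCircle (by fun_prop)
    exact_mod_cast h2
  have hint : ∫ t, q.eval (z * e t) * conj (e t) ^ c * D t ^ 2 ∂AddCircle.haarAddCircle =
      (z : ℂ) ^ c * ∑ j ∈ Finset.range (N + 1), ((j : ℂ) + 1) * (q.coeff (j + c) * (z : ℂ) ^ j) := by
    have h1 : ∀ t, q.eval (z * e t) * conj (e t) ^ c * D t ^ 2 =
        ∑ a ∈ Finset.range (N + 1), ∑ b ∈ Finset.range (N + 1),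
          q.eval (z * e t) * conj (e t) ^ (a + b + c) := fun t => by
      rw [pow_two, Finset.sum_mul_sum, Finset.mul_sum]
      refine Finset.sum_congr rfl fun a _ => ?_
      rw [Finset.mul_sum]
      refine Finset.sum_congr rfl fun b _ => ?_
      ring
    simp only [h1]
    rw [integral_finsetSum _ fun a _ => Continuous.integrable_haarAddCircle (by fun_prop)]
    rw [Finset.sum_congr rfl fun a _ => integral_finsetSum _ fun b _ =>
      Continuous.integrable_haarAddCircle (by fun_prop)]
    simp only [e, integral_eval_mul_conj_pow]
    rw [sum_range_sum_range_add (F := fun j => q.coeff (j + c) * (z : ℂ) ^ (j + c))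
      fun j hj => by rw [coeff_eq_zero_of_natDegree_lt (by omega), zero_mul], Finset.mul_sum]
    refine Finset.sum_congr rfl fun j _ => ?_
    ring
  have hnorm := congrArg norm hint
  rw [norm_mul, norm_pow, Circle.norm_coe, one_pow, one_mul] at hnorm
  rw [← hnorm, mul_comm, ← hsq, ← integral_const_mul]
  refine norm_integral_le_of_norm_le ?_ (Eventually.of_forall fun t => ?_)
  · refine Integrable.const_mul ?_ S
    exact (Continuous.integrable_of_hasCompactSupport (by fun_prop)
      (HasCompactSupport.of_compactSpace _))
  · rw [norm_mul, norm_mul, norm_pow, norm_pow, RCLike.norm_conj, Circle.norm_coe, one_pow, mul_one]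
    have := hS (z * AddCircle.toCircle t)
    rw [Circle.coe_mul] at this
    gcongr

/-- As in the Schwarz lemma: `q / X ^ M` has the modulus of `q` on the circle, and the maximum
principle applies to it. -/
theorem norm_eval_real_mul_le {q : ℂ[X]} {M : ℕ} (hM : X ^ M ∣ q) {S : ℝ}
    (hS : ∀ z : Circle, ‖q.eval (z : ℂ)‖ ≤ S) {r : ℝ} (h0 : 0 ≤ r) (h1 : r ≤ 1) (z : Circle) :
    ‖q.eval (r * z : ℂ)‖ ≤ r ^ M * S := by
  obtain ⟨p, rfl⟩ := hM
  have hp : ‖p.eval (r * z : ℂ)‖ ≤ S := by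
    refine Complex.norm_le_of_forall_mem_frontier_norm_le (U := Metric.ball 0 1)
      Metric.isBounded_ball (f := fun w => p.eval w) p.differentiable.diffContOnCl ?_ ?_
    · intro w hw
      rw [frontier_ball _ one_ne_zero, mem_sphere_zero_iff_norm] at hw
      have := hS ⟨w, mem_sphere_zero_iff_norm.2 hw⟩
      simpa [hw] using this
    · rw [closure_ball _ one_ne_zero, mem_closedBall_zero_iff, norm_mul, Circle.norm_coe, mul_one,
        Complex.norm_real, Real.norm_of_nonneg h0]
      exact h1
  rw [eval_mul, norm_mul, eval_pow, eval_X, norm_pow, norm_mul, Circle.norm_coe, mul_one,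
    Complex.norm_real, Real.norm_of_nonneg h0]
  gcongr

/-- The polynomial is `h(z) = ∫_0^1 r^k q(rz) dr`. The gain comes from `|q(rz)| ≤ r^M S`, because
`r^(M+k)` has integral `1 / (M + k + 1)`. -/
theorem exists_integrated_polynomial {q : ℂ[X]} {M N : ℕ} (hq : q.natDegree ≤ N) (hM : X ^ M ∣ q)
    {S : ℝ} (hS : ∀ z : Circle, ‖q.eval (z : ℂ)‖ ≤ S) (k : ℕ) :
    ∃ h : ℂ[X], h.natDegree ≤ N ∧ (∀ s : ℕ, ((s : ℂ) + k + 1) * h.coeff s = q.coeff s) ∧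
      ∀ z : Circle, ‖h.eval (z : ℂ)‖ ≤ S / (M + k + 1) := by
  let h : ℂ[X] := ∑ s ∈ Finset.range (N + 1), monomial s (q.coeff s / (s + k + 1))
  have hpos : ∀ s : ℕ, (s : ℂ) + k + 1 ≠ 0 := fun s => by exact_mod_cast Nat.succ_ne_zero (s + k)
  refine ⟨h, natDegree_sum_le_of_forall_le _ _ fun s hs => ?_, fun s => ?_, fun z => ?_⟩
  · exact (natDegree_monomial_le _).trans (Nat.lt_succ_iff.1 (Finset.mem_range.1 hs))
  · simp only [h, finsetSum_coeff, coeff_monomial, Finset.sum_ite_eq']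
    split_ifs with hs
    · exact mul_div_cancel₀ _ (hpos s)
    · rw [mul_zero, coeff_eq_zero_of_natDegree_lt (by simp at hs; omega)]
  · have hint : ∫ r in (0 : ℝ)..1, (r : ℂ) ^ k * q.eval (r * z : ℂ) = h.eval (z : ℂ) := by
      have h1 : ∀ r : ℝ, (r : ℂ) ^ k * q.eval (r * z : ℂ) =
          ∑ s ∈ Finset.range (N + 1), q.coeff s * (z : ℂ) ^ s * ((r ^ (s + k) : ℝ) : ℂ) :=
        fun r => by
          rw [eval_eq_sum_range' (n := N + 1) (by omega), Finset.mul_sum]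
          refine Finset.sum_congr rfl fun s _ => ?_
          push_cast
          ring
      simp only [h1]
      rw [intervalIntegral.integral_finsetSum fun s _ =>
        Continuous.intervalIntegrable (by fun_prop) _ _]
      simp only [intervalIntegral.integral_const_mul, intervalIntegral.integral_ofReal,
        integral_pow, h, eval_finsetSum, eval_monomial]
      refine Finset.sum_congr rfl fun s _ => ?_
      have := hpos s
      push_cast
      rw [one_pow, zero_pow (by omega)]
      ring
    rw [← hint]
    calc ‖∫ r in (0 : ℝ)..1, (r : ℂ) ^ k * q.eval (r * z : ℂ)‖
        ≤ ∫ r in (0 : ℝ)..1, r ^ (M + k) * S := by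
          refine intervalIntegral.norm_integral_le_of_norm_le zero_le_one
            (Eventually.of_forall fun r hr => ?_) (Continuous.intervalIntegrable (by fun_prop) _ _)
          rw [norm_mul, norm_pow, Complex.norm_real, Real.norm_of_nonneg hr.1.le, pow_add,
            mul_comm (r ^ M), mul_assoc]
          exact mul_le_mul_of_nonneg_left (norm_eval_real_mul_le hM hS hr.1.le hr.2 z)
            (pow_nonneg hr.1.le _)
      _ = S / (M + k + 1) := by
          rw [intervalIntegral.integral_mul_const, integral_pow]
          push_cast
          rw [one_pow, zero_pow (by omega)]
          ring

/-! ### Projective bounds for divided differences of polynomials -/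

/-- There are `(k + 1) * (N + 1) ^ k` elementary tensors, each of norm at most `(N + 1) * S / (M + k
+ 1)`: a choice of the summed slot and of the exponents in the other `k` slots. -/
theorem hasProjBound_homogeneousSum {q : ℂ[X]} {M N : ℕ} (hq : q.natDegree ≤ N) (hM : X ^ M ∣ q)
    {S : ℝ} (hS : ∀ z : Circle, ‖q.eval (z : ℂ)‖ ≤ S) (k : ℕ) :
    HasProjBound (fun z : Fin (k + 1) → Circle => homogeneousSum q fun i => (z i : ℂ))
      ((k + 1) * (N + 1) ^ (k + 1) / (M + k + 1) * S) := by
  obtain ⟨h, hN, hc, hb⟩ := exists_integrated_polynomial hq hM hS k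
  let G : ℕ → C(Circle, ℂ) := fun c =>
    ⟨fun z => ∑ j ∈ Finset.range (N + 1), ((j : ℂ) + 1) * (h.coeff (j + c) * (z : ℂ) ^ j),
      by fun_prop⟩
  have hS0 : 0 ≤ S / (M + k + 1) := (norm_nonneg _).trans (hb 1)
  have hG : ∀ c, ‖G c‖ ≤ (N + 1) * (S / (M + k + 1)) := fun c =>
    (ContinuousMap.norm_le _ (by positivity)).2 fun z => norm_sum_succ_mul_coeff_le hN hb c z
  let P : ℕ → C(Circle, ℂ) := fun a => ⟨fun z => (z : ℂ) ^ a, by fun_prop⟩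
  have hP : ∀ a, ‖P a‖ ≤ 1 := fun a =>
    (ContinuousMap.norm_le _ zero_le_one).2 fun z => by
      simp only [P, ContinuousMap.coe_mk, norm_pow, Circle.norm_coe, one_pow, le_refl]
  -- Slot `a.1` carries the function already summed over its own exponent; the other slots carry
  -- monomials of norm at most one.
  let f : Fin (k + 1) × (Fin k → Fin (N + 1)) → Fin (k + 1) → C(Circle, ℂ) := fun a =>
    a.1.insertNth (G (∑ l, (a.2 l : ℕ))) fun l => P (a.2 l)
  have hf : ∀ a, ∏ j, ‖f a j‖ ≤ (N + 1) * (S / (M + k + 1)) := fun a => by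
    rw [Fin.prod_univ_succAbove _ a.1]
    simp only [f, Fin.insertNth_apply_same, Fin.insertNth_apply_succAbove]
    refine (mul_le_of_le_one_right (norm_nonneg _) ?_).trans (hG _)
    exact Finset.prod_le_one (fun _ _ => norm_nonneg _) fun _ _ => hP _
  have key := HasProjBound.sum fun a => (HasProjBound.elementary (f a)).mono (hf a)
  have hval : ∀ z : Fin (k + 1) → Circle,
      ∑ a, ∏ j, f a j (z j) = homogeneousSum q fun i => (z i : ℂ) := fun z => by
    rw [homogeneousSum_eq_sum hq]
    -- The factor `|j| + k + 1` relating `q` to `h` is distributed over the slots as `∑ i, (j i +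
    -- 1)`.
    have h1 : ∀ j : Fin (k + 1) → Fin (N + 1),
        q.coeff (∑ i, (j i : ℕ)) * ∏ i, (z i : ℂ) ^ (j i : ℕ) =
        ∑ i, ((j i : ℂ) + 1) * (h.coeff (∑ i, (j i : ℕ)) * ∏ i, (z i : ℂ) ^ (j i : ℕ)) :=
      fun j => by
        rw [← Finset.sum_mul, ← mul_assoc, ← hc]
        simp [Finset.sum_add_distrib, add_assoc]
    simp only [h1]
    rw [Finset.sum_comm, Fintype.sum_prod_type]
    refine Finset.sum_congr rfl fun i _ => ?_
    rw [← (Fin.insertNthEquiv (fun _ => Fin (N + 1)) i).sum_comp, Fintype.sum_prod_type,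
      Finset.sum_comm]
    refine Finset.sum_congr rfl fun c _ => ?_
    simp only [Fin.insertNthEquiv_apply, Fin.insertNth_apply_same, Fin.sum_univ_succAbove _ i,
      Fin.prod_univ_succAbove _ i, Fin.insertNth_apply_succAbove, f, G, P, ContinuousMap.coe_mk]
    rw [Finset.sum_range, Finset.sum_mul]
    refine Finset.sum_congr rfl fun a _ => ?_
    ring
  simp only [hval] at key
  refine key.mono (le_of_eq ?_)
  simp only [Finset.sum_const, Finset.card_univ, Fintype.card_prod, Fintype.card_fin,
    Fintype.card_fun, nsmul_eq_mul]
  push_cast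
  ring

theorem coeff_iterate_divX (p : ℂ[X]) (k n : ℕ) : (divX^[k] p).coeff n = p.coeff (n + k) := by
  induction k generalizing n with
  | zero => rfl
  | succ k ih => rw [Function.iterate_succ_apply', coeff_divX, ih]; ring_nf

theorem natDegree_iterate_divX_le (p : ℂ[X]) (k : ℕ) : (divX^[k] p).natDegree ≤ p.natDegree := by
  induction k with
  | zero => rfl
  | succ k ih => rw [Function.iterate_succ_apply']; exact (natDegree_divX_le _).trans ih

theorem X_pow_mul_iterate_divX {p : ℂ[X]} {k : ℕ} (h : X ^ k ∣ p) : X ^ k * divX^[k] p = p := by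
  ext n
  rw [coeff_X_pow_mul', coeff_iterate_divX]
  split_ifs with hn
  · rw [Nat.sub_add_cancel hn]
  · rw [X_pow_dvd_iff.1 h n (by omega)]

theorem X_pow_dvd_iterate_divX {p : ℂ[X]} {M : ℕ} (h : X ^ M ∣ p) (k : ℕ) :
    X ^ (M - k) ∣ divX^[k] p :=
  X_pow_dvd_iff.2 fun d hd => by
    rw [coeff_iterate_divX, X_pow_dvd_iff.1 h _ (by omega)]

theorem norm_eval_iterate_divX {p : ℂ[X]} {k : ℕ} (h : X ^ k ∣ p) (z : Circle) :
    ‖(divX^[k] p).eval (z : ℂ)‖ = ‖p.eval (z : ℂ)‖ := by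
  conv_rhs => rw [← X_pow_mul_iterate_divX h]
  rw [eval_mul, norm_mul, eval_pow, eval_X, norm_pow, Circle.norm_coe, one_pow, one_mul]

theorem hasProjDividedDiffs_eval_of_homogeneousSum {p : ℂ[X]} {m : ℕ} {B : ℝ}
    (h : ∀ k ≤ m, HasProjBound
      (fun z : Fin (k + 1) → Circle => homogeneousSum (divX^[k] p) fun i => (z i : ℂ)) B) :
    HasProjDividedDiffs m (fun z => p.eval (z : ℂ)) B := by
  refine ⟨fun k z => homogeneousSum (divX^[k] p) fun i => (z i : ℂ), h,
    fun z => homogeneousSum_fin_one p _, fun k _ z => ?_⟩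
  have h1 := homogeneousSum_init (divX^[k] p) fun i => (z i : ℂ)
  have h2 := homogeneousSum_tail (divX^[k] p) fun i => (z i : ℂ)
  beta_reduce
  rw [Function.iterate_succ_apply']
  refine Eq.trans ?_ (congrArg₂ (· - ·) h1 h2).symm
  ring

/-- A bound without control of its size, sufficient for the finitely many blocks of low frequency.
-/
theorem exists_hasProjDividedDiffs_eval (p : ℂ[X]) (m : ℕ) :
    ∃ B, HasProjDividedDiffs m (fun z => p.eval (z : ℂ)) B := by
  have h : ∀ k : ℕ, ∃ B, HasProjBound
      (fun z : Fin (k + 1) → Circle => homogeneousSum (divX^[k] p) fun i => (z i : ℂ)) B :=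
    fun k => by
      let F : C(Circle, ℂ) := ⟨fun z => (divX^[k] p).eval (z : ℂ), by fun_prop⟩
      exact ⟨_, hasProjBound_homogeneousSum le_rfl (M := 0) (by simp) F.norm_coe_le_norm k⟩
  choose b hb using h
  refine ⟨∑ k ∈ Finset.range (m + 1), b k, hasProjDividedDiffs_eval_of_homogeneousSum
    fun k hk => (hb k).mono ?_⟩
  exact Finset.single_le_sum (fun k _ => (hb k).nonneg) (Finset.mem_range.2 (by omega))

theorem succ_mul_pow_succ_le {k m N : ℕ} (hk : k ≤ m) :
    ((k : ℝ) + 1) * (N + 1) ^ (k + 1) ≤ (m + 1) * (N + 1) ^ (m + 1) := by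
  have h1 : (k : ℝ) ≤ m := by exact_mod_cast hk
  have h2 : (1 : ℝ) ≤ (N : ℝ) + 1 := by simp
  have h3 : ((N : ℝ) + 1) ^ (k + 1) ≤ (N + 1) ^ (m + 1) := pow_le_pow_right₀ h2 (by omega)
  gcongr

/-- Dividing by `X ^ k` keeps the modulus on the circle and lowers the order of vanishing to `M -
k`; the `k` in the denominator `(M - k) + k + 1` makes up for it exactly. -/
theorem hasProjDividedDiffs_eval {p : ℂ[X]} {m M N : ℕ} (hp : p.natDegree ≤ N) (hM : X ^ M ∣ p)
    (hmM : m ≤ M) {S : ℝ} (hS : ∀ z : Circle, ‖p.eval (z : ℂ)‖ ≤ S) :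
    HasProjDividedDiffs m (fun z => p.eval (z : ℂ))
      ((m + 1) * (N + 1) ^ (m + 1) / (M + 1) * S) := by
  have hS0 : 0 ≤ S := (norm_nonneg _).trans (hS 1)
  refine hasProjDividedDiffs_eval_of_homogeneousSum fun k hk => ?_
  refine (hasProjBound_homogeneousSum ((natDegree_iterate_divX_le p k).trans hp)
    (X_pow_dvd_iterate_divX hM k) (S := S) (fun z => ?_) k).mono ?_
  · rw [norm_eval_iterate_divX ((pow_dvd_pow X (hk.trans hmM)).trans hM)]
    exact hS z
  · rw [Nat.cast_sub (hk.trans hmM), sub_add_cancel]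
    have := succ_mul_pow_succ_le (N := N) hk
    gcongr

/-- On the circle `z̄ = 1/z`, and `𝔇^k z^{-s} = (-1)^k ∏ z_j⁻¹ · h_{s-1}(z_0⁻¹, …, z_k⁻¹)`. Only one
power of `X` is removed, whatever `k` is, so no condition linking `m` and `M` arises. -/
theorem hasProjDividedDiffs_eval_conj {p : ℂ[X]} {m M N : ℕ} (hp : p.natDegree ≤ N)
    (hM : X ^ (M + 1) ∣ p) {S : ℝ} (hS : ∀ z : Circle, ‖p.eval (z : ℂ)‖ ≤ S) :
    HasProjDividedDiffs m (fun z => p.eval (conj (z : ℂ)))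
      ((m + 1) * (N + 1) ^ (m + 1) / (M + 1) * S) := by
  have hS0 : 0 ≤ S := (norm_nonneg _).trans (hS 1)
  have hX : X ^ 1 ∣ p := (pow_dvd_pow X (by omega)).trans hM
  refine ⟨fun k z => (-1) ^ k * (∏ j, conj (z j : ℂ)) *
    homogeneousSum p.divX fun j => (((z j)⁻¹ : Circle) : ℂ), fun k hk => ?_, fun z => ?_,
    fun k _ z => ?_⟩
  · refine ((hasProjBound_homogeneousSum ((natDegree_divX_le p).trans hp)
      (X_pow_dvd_iterate_divX hM 1) (S := S) (fun z => ?_) k).comp_inv_mul_prod_conj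
      ((-1) ^ k) (by simp) (by omega)).mono ?_
    · exact (norm_eval_iterate_divX hX z).trans_le (hS z)
    · have := succ_mul_pow_succ_le (N := N) hk
      have hk0 : (0 : ℝ) ≤ k := k.cast_nonneg
      rw [Nat.add_sub_cancel]
      gcongr
      linarith
  · have h := X_pow_mul_iterate_divX hX
    beta_reduce
    rw [homogeneousSum_fin_one]
    conv_rhs => rw [← h]
    simp [← Circle.coe_inv_eq_conj]
  · have h1 := homogeneousSum_init p.divX fun j => (((z j)⁻¹ : Circle) : ℂ)
    have h2 := homogeneousSum_tail p.divX fun j => (((z j)⁻¹ : Circle) : ℂ)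
    -- Since `z * z̄ = 1`, multiplying by the omitted coordinate cancels its conjugate.
    have h3 : ∏ j, conj ((Fin.init z : Fin (k + 1) → Circle) j : ℂ) =
        z (Fin.last (k + 1)) * ∏ j, conj (z j : ℂ) := by
      rw [Fin.prod_univ_castSucc (n := k + 1), mul_left_comm, Complex.mul_conj]
      simp [Fin.init]
    have h4 : ∏ j, conj ((Fin.tail z : Fin (k + 1) → Circle) j : ℂ) =
        z 0 * ∏ j, conj (z j : ℂ) := by
      rw [Fin.prod_univ_succ (n := k + 1), ← mul_assoc, Complex.mul_conj]
      simp [Fin.tail]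
    have h5 : ∀ j, (z j : ℂ) * ((z j)⁻¹ : Circle) = 1 := fun j => by simp
    change homogeneousSum p.divX (fun j => (((Fin.init z j)⁻¹ : Circle) : ℂ)) = _ at h1
    change homogeneousSum p.divX (fun j => (((Fin.tail z j)⁻¹ : Circle) : ℂ)) = _ at h2
    beta_reduce
    rw [h1, h2, h3, h4, pow_succ]
    linear_combination (-1 : ℂ) ^ k * (∏ j, conj (z j : ℂ)) *
      homogeneousSum p.divX.divX (fun j => (((z j)⁻¹ : Circle) : ℂ)) *
      (h5 (Fin.last (k + 1)) - h5 0)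

/-! ### Uniqueness of Fourier coefficients for integrable functions -/

/-- Integration against `f` is a continuous functional on `C(𝕋)` that kills the exponentials, whose
span is dense. -/
theorem integral_mul_eq_zero_of_fourierCoeff_eq_zero {f : UnitAddCircle → ℂ}
    (hf : Integrable f AddCircle.haarAddCircle) (h : ∀ n, fourierCoeff f n = 0)
    (g : C(UnitAddCircle, ℂ)) : ∫ t, g t * f t ∂AddCircle.haarAddCircle = 0 := by
  have hint : ∀ g : C(UnitAddCircle, ℂ),
      Integrable (fun t => g t * f t) AddCircle.haarAddCircle := fun g =>
    hf.bdd_mul g.continuous.aestronglyMeasurable (Eventually.of_forall g.norm_coe_le_norm)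
  let L : C(UnitAddCircle, ℂ) →ₗ[ℂ] ℂ :=
    { toFun := fun g => ∫ t, g t * f t ∂AddCircle.haarAddCircle
      map_add' := fun g₁ g₂ => by
        simp only [ContinuousMap.add_apply, add_mul]
        exact integral_add (hint g₁) (hint g₂)
      map_smul' := fun c g => by
        simp only [ContinuousMap.smul_apply, smul_eq_mul, mul_assoc, integral_const_mul,
          RingHom.id_apply] }
  let L' := L.mkContinuous (∫ t, ‖f t‖ ∂AddCircle.haarAddCircle) fun g => by
    rw [mul_comm, ← integral_const_mul]
    refine norm_integral_le_of_norm_le (hf.norm.const_mul _) (Eventually.of_forall fun t => ?_)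
    rw [norm_mul]
    exact mul_le_mul_of_nonneg_right (g.norm_coe_le_norm t) (norm_nonneg _)
  have hspan : Submodule.span ℂ (Set.range (@fourier 1)) ≤ L'.toLinearMap.ker := by
    rw [Submodule.span_le]
    rintro _ ⟨n, rfl⟩
    simpa [fourierCoeff, L', L] using h (-n)
  have htop := Submodule.topologicalClosure_minimal _ hspan L'.isClosed_ker
  rw [span_fourier_closure_eq_top] at htop
  exact htop (Submodule.mem_top : g ∈ ⊤)

/-- Indicators of closed sets are bounded limits of continuous functions, so `f` has integral zero
over every closed set. -/
theorem ae_eq_zero_of_fourierCoeff_eq_zero {f : UnitAddCircle → ℂ}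
    (hf : Integrable f AddCircle.haarAddCircle) (h : ∀ n, fourierCoeff f n = 0) :
    f =ᵐ[AddCircle.haarAddCircle] 0 := by
  refine ae_eq_zero_of_forall_setIntegral_isClosed_eq_zero hf fun F hF => ?_
  have hpos : ∀ n : ℕ, 0 < (1 : ℝ) / (n + 1) := fun n => Nat.one_div_pos_of_nat
  let u : ℕ → UnitAddCircle → ℂ := fun n t => ((thickenedIndicator (hpos n) F t : ℝ) : ℂ) * f t
  have hu : ∀ n, ∫ t, u n t ∂AddCircle.haarAddCircle = 0 := fun n =>
    integral_mul_eq_zero_of_fourierCoeff_eq_zero hf h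
      ⟨fun t => ((thickenedIndicator (hpos n) F t : ℝ) : ℂ), by fun_prop⟩
  have hlim := thickenedIndicator_tendsto_indicator_closure hpos
    tendsto_one_div_add_atTop_nhds_zero_nat F
  rw [tendsto_pi_nhds] at hlim
  have hconv : Tendsto (fun n => ∫ t, u n t ∂AddCircle.haarAddCircle) atTop
      (𝓝 (∫ t, F.indicator f t ∂AddCircle.haarAddCircle)) := by
    refine tendsto_integral_of_dominated_convergence (fun t => ‖f t‖) (fun n => ?_) hf.norm
      (fun n => Eventually.of_forall fun t => ?_) (Eventually.of_forall fun t => ?_)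
    · refine Continuous.aestronglyMeasurable ?_ |>.mul hf.aestronglyMeasurable
      fun_prop
    · rw [norm_mul, Complex.norm_real, Real.norm_of_nonneg (NNReal.coe_nonneg _)]
      refine mul_le_of_le_one_left (norm_nonneg _) ?_
      exact_mod_cast thickenedIndicator_le_one (hpos n) F t
    · have h1 := hlim t
      rw [hF.closure_eq] at h1
      have h2 : F.indicator f t = (((F.indicator (fun _ => (1 : NNReal)) t : NNReal) : ℝ) : ℂ) * f t := by
        by_cases ht : t ∈ F <;> simp [ht]
      rw [h2]
      refine Tendsto.mul_const _ ?_
      exact (Complex.continuous_ofReal.tendsto _).comp ((NNReal.continuous_coe.tendsto _).comp h1)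
  rw [integral_indicator hF.measurableSet] at hconv
  simp only [hu] at hconv
  exact tendsto_nhds_unique hconv tendsto_const_nhds

/-! ### Dyadic blocks as polynomials -/

/-- The endpoints are included because the set where `w` is nonzero is open, hence lies in the
interior of the interval. -/
theorem IsDyadicResolution.eq_zero_of_le {w : ℝ → ℝ} (hw : IsDyadicResolution w) {x : ℝ}
    (hx : x ≤ 1 / 2 ∨ 2 ≤ x) : w x = 0 := by
  by_contra h
  have hsub : Function.support w ⊆ interior (Set.Icc (1 / 2) 2) :=
    interior_maximal ((subset_tsupport w).trans hw.tsupport_subset)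
      hw.contDiff.continuous.isOpen_support
  rw [interior_Icc] at hsub
  have := hsub h
  rcases hx with hx | hx <;> linarith [this.1, this.2]

/-- For `k ≥ 2` the scales `2^n`, `n ≥ 0`, contribute nothing to the full resolution since `2^n k ≥
2`. For `k ≤ 1` every argument is at most `1/2`. -/
theorem IsDyadicResolution.hasSum_div_two_pow {w : ℝ → ℝ} (hw : IsDyadicResolution w) (k : ℤ) :
    HasSum (fun n : ℕ => w ((k : ℝ) / 2 ^ (n + 1))) (if 2 ≤ k then 1 else 0) := by
  split_ifs with hk
  · have hk' : (2 : ℝ) ≤ k := by exact_mod_cast hk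
    have h := hw.hasSum k (by linarith)
    have hinj : Function.Injective Int.negSucc := fun a b hab => Int.negSucc.inj hab
    rw [← hinj.hasSum_iff] at h
    · refine h.congr_fun fun n => ?_
      simp only [Function.comp_apply, zpow_negSucc]
      rw [div_eq_inv_mul]
    · intro n hn
      cases n with
      | negSucc n => exact absurd ⟨n, rfl⟩ hn
      | ofNat n =>
        refine hw.eq_zero_of_le (Or.inr ?_)
        have : (1 : ℝ) ≤ 2 ^ n := one_le_pow₀ one_le_two
        simp only [Int.ofNat_eq_natCast, zpow_natCast]
        nlinarith
  · have : ∀ n : ℕ, w ((k : ℝ) / 2 ^ (n + 1)) = 0 := fun n => by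
      refine hw.eq_zero_of_le (Or.inl ?_)
      have hk' : (k : ℝ) ≤ 1 := by exact_mod_cast (by omega : k ≤ 1)
      have : (1 : ℝ) ≤ 2 ^ n := one_le_pow₀ one_le_two
      rw [div_le_iff₀ (by positivity), pow_succ]
      linarith
    simpa only [this] using hasSum_zero

/-- The Fourier coefficients, weighted by the values of `w (k / 2 ^ (n + 1))`, as an analytic
polynomial. -/
noncomputable def besovPolynomial (w : ℝ → ℝ) (n : ℕ) (c : ℤ → ℂ) : ℂ[X] :=
  ∑ j ∈ Finset.range (2 ^ (n + 2) + 1), monomial j ((w ((j : ℝ) / 2 ^ (n + 1)) : ℂ) * c j)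

theorem eval_besovPolynomial (w : ℝ → ℝ) (n : ℕ) (c : ℤ → ℂ) (z : ℂ) :
    (besovPolynomial w n c).eval z = ∑ j ∈ Finset.range (2 ^ (n + 2) + 1),
      (w ((j : ℝ) / 2 ^ (n + 1)) : ℂ) * c j * z ^ j := by
  simp [besovPolynomial, eval_finsetSum]

theorem natDegree_besovPolynomial_le (w : ℝ → ℝ) (n : ℕ) (c : ℤ → ℂ) :
    (besovPolynomial w n c).natDegree ≤ 2 ^ (n + 2) :=
  natDegree_sum_le_of_forall_le _ _ fun _ hs =>
    (natDegree_monomial_le _).trans (Nat.lt_succ_iff.1 (Finset.mem_range.1 hs))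

/-- The extra power comes from `w (1 / 2) = 0`; it is the one spent on `z̄` in
`hasProjDividedDiffs_eval_conj`. -/
theorem IsDyadicResolution.X_pow_dvd_besovPolynomial {w : ℝ → ℝ} (hw : IsDyadicResolution w)
    (n : ℕ) (c : ℤ → ℂ) : X ^ (2 ^ n + 1) ∣ besovPolynomial w n c := by
  refine X_pow_dvd_iff.2 fun d hd => ?_
  simp only [besovPolynomial, finsetSum_coeff, coeff_monomial, Finset.sum_ite_eq']
  rw [hw.eq_zero_of_le (Or.inl ?_)]
  · simp
  · have : (d : ℝ) ≤ 2 ^ n := by exact_mod_cast Nat.lt_succ_iff.1 hd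
    rw [div_le_iff₀ (by positivity), pow_succ]
    linarith

theorem fourierCoeff_sum_zpow {ι : Type*} (s : Finset ι) (a : ι → ℂ) (κ : ι → ℤ) (k : ℤ) :
    fourierCoeff (fun t : UnitAddCircle => ∑ i ∈ s, a i * (AddCircle.toCircle t : ℂ) ^ κ i) k =
      ∑ i ∈ s, if κ i = k then a i else 0 := by
  have h : ∀ t : UnitAddCircle, fourier (-k) t • ∑ i ∈ s, a i * (AddCircle.toCircle t : ℂ) ^ κ i =
      ∑ i ∈ s, a i * (AddCircle.toCircle t : ℂ) ^ (κ i - k) := fun t => by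
    rw [smul_eq_mul, Finset.mul_sum]
    refine Finset.sum_congr rfl fun i _ => ?_
    rw [fourier_apply, AddCircle.toCircle_zsmul, Circle.coe_zpow, sub_eq_add_neg,
      zpow_add₀ (Circle.coe_ne_zero _)]
    ring
  simp only [fourierCoeff, h]
  rw [integral_finsetSum]
  · simp only [integral_const_mul, integral_toCircle_zpow, sub_eq_zero, mul_ite, mul_one, mul_zero]
  · intro i _
    exact Continuous.integrable_haarAddCircle (continuous_const.mul
      (continuous_coe_toCircle.zpow₀ _ fun t => Or.inl (Circle.coe_ne_zero _)))

theorem IsDyadicResolution.sum_range_ite {w : ℝ → ℝ} (hw : IsDyadicResolution w) (n : ℕ)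
    (c : ℤ → ℂ) (k : ℤ) :
    (∑ j ∈ Finset.range (2 ^ (n + 2) + 1),
      if (j : ℤ) = k then (w ((j : ℝ) / 2 ^ (n + 1)) : ℂ) * c j else 0) =
      (w ((k : ℝ) / 2 ^ (n + 1)) : ℂ) * c k := by
  by_cases hk : 0 ≤ k
  · lift k to ℕ using hk
    simp only [Nat.cast_inj, Finset.sum_ite_eq', Int.cast_natCast]
    split_ifs with h
    · rfl
    · rw [hw.eq_zero_of_le (Or.inr ?_)]
      · simp
      · have : (2 : ℝ) ^ (n + 2) ≤ k := by
          exact_mod_cast (by simp at h; omega : 2 ^ (n + 2) ≤ k)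
        rw [le_div_iff₀ (by positivity)]
        refine le_trans (le_of_eq ?_) this
        ring
  · rw [hw.eq_zero_of_le (Or.inl ?_)]
    · rw [Complex.ofReal_zero, zero_mul]
      exact Finset.sum_eq_zero fun j _ => if_neg (by omega)
    · have : (k : ℝ) ≤ 0 := by exact_mod_cast (by omega : k ≤ 0)
      exact (div_nonpos_of_nonpos_of_nonneg this (by positivity)).trans (by norm_num)

theorem IsDyadicResolution.fourierCoeff_besovPolynomial {w : ℝ → ℝ} (hw : IsDyadicResolution w)
    (n : ℕ) (c : ℤ → ℂ) (k : ℤ) :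
    fourierCoeff (onAngle fun z => (besovPolynomial w n c).eval (z : ℂ)) k =
      (w ((k : ℝ) / 2 ^ (n + 1)) : ℂ) * c k := by
  have := fourierCoeff_sum_zpow (Finset.range (2 ^ (n + 2) + 1))
    (fun j => (w ((j : ℝ) / 2 ^ (n + 1)) : ℂ) * c j) (fun j => (j : ℤ)) k
  rw [hw.sum_range_ite] at this
  rw [← this]
  congr 1
  funext t
  simp [onAngle, eval_besovPolynomial]

theorem IsDyadicResolution.fourierCoeff_besovPolynomial_conj {w : ℝ → ℝ}
    (hw : IsDyadicResolution w) (n : ℕ) (c : ℤ → ℂ) (k : ℤ) :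
    fourierCoeff (onAngle fun z => (besovPolynomial w n c).eval (conj (z : ℂ))) k =
      (w (((-k : ℤ) : ℝ) / 2 ^ (n + 1)) : ℂ) * c (-k) := by
  have := fourierCoeff_sum_zpow (Finset.range (2 ^ (n + 2) + 1))
    (fun j => (w ((j : ℝ) / 2 ^ (n + 1)) : ℂ) * c j) (fun j => -(j : ℤ)) k
  simp only [neg_eq_iff_eq_neg] at this
  rw [hw.sum_range_ite] at this
  rw [← this]
  congr 1
  funext t
  simp [onAngle, eval_besovPolynomial, ← Circle.coe_inv_eq_conj]

theorem circleConv_sum_zpow {φ : Circle → ℂ} (hφ : Integrable (onAngle φ) AddCircle.haarAddCircle)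
    {ι : Type*} (s : Finset ι) (a : ι → ℂ) (κ : ι → ℤ) (z : Circle) :
    circleConv φ (fun u => ∑ i ∈ s, a i * (u : ℂ) ^ κ i) z =
      ∑ i ∈ s, a i * fourierCoeff (onAngle φ) (κ i) * (z : ℂ) ^ κ i := by
  have h : ∀ t : UnitAddCircle, φ (AddCircle.toCircle t) *
      ∑ i ∈ s, a i * ((z * (AddCircle.toCircle t)⁻¹ : Circle) : ℂ) ^ κ i =
      ∑ i ∈ s, a i * (z : ℂ) ^ κ i * (fourier (-κ i) t • onAngle φ t) := fun t => by
    rw [Finset.mul_sum]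
    refine Finset.sum_congr rfl fun i _ => ?_
    rw [fourier_apply, AddCircle.toCircle_zsmul, Circle.coe_zpow, Circle.coe_mul, Circle.coe_inv,
      mul_zpow, inv_zpow, zpow_neg, smul_eq_mul, onAngle]
    ring
  simp only [circleConv, h]
  rw [integral_finsetSum _ fun i _ => (hφ.fourier_smul _).const_mul _]
  refine Finset.sum_congr rfl fun i _ => ?_
  rw [integral_const_mul, fourierCoeff]
  ring

theorem IsDyadicResolution.besovKernel_succ {w : ℝ → ℝ} (hw : IsDyadicResolution w) (n : ℕ)
    (z : Circle) : besovKernel w (n + 1) z = ∑ j ∈ Finset.range (2 ^ (n + 2) + 1),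
      (w ((j : ℝ) / 2 ^ (n + 1)) : ℂ) * (z : ℂ) ^ (j : ℤ) := by
  have h := fun k => hw.sum_range_ite n (fun k => (z : ℂ) ^ k) k
  rw [besovKernel]
  have h2 : ∑ j ∈ Finset.range (2 ^ (n + 2) + 1),
      (w ((j : ℝ) / 2 ^ (n + 1)) : ℂ) * (z : ℂ) ^ (j : ℤ) =
      ∑ k ∈ (Finset.range (2 ^ (n + 2) + 1)).map Nat.castEmbedding,
        (w (((k : ℤ) : ℝ) / 2 ^ (n + 1)) : ℂ) * (z : ℂ) ^ k := by
    simp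
  rw [h2]
  refine tsum_eq_sum fun k hk => ?_
  rw [← h k]
  refine Finset.sum_eq_zero fun j hj => if_neg fun hjk => hk ?_
  exact Finset.mem_map.2 ⟨j, hj, hjk⟩

theorem IsDyadicResolution.circleConv_besovKernel {w : ℝ → ℝ} (hw : IsDyadicResolution w)
    {φ : Circle → ℂ} (hφ : Integrable (onAngle φ) AddCircle.haarAddCircle) (n : ℕ) :
    circleConv φ (besovKernel w (n + 1)) =
      fun z : Circle => (besovPolynomial w n (fourierCoeff (onAngle φ))).eval (z : ℂ) := by
  funext z
  rw [funext (hw.besovKernel_succ n), circleConv_sum_zpow hφ, eval_besovPolynomial]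
  simp

theorem IsDyadicResolution.circleConv_besovKernelSharp {w : ℝ → ℝ} (hw : IsDyadicResolution w)
    {φ : Circle → ℂ} (hφ : Integrable (onAngle φ) AddCircle.haarAddCircle) (n : ℕ) :
    circleConv φ (besovKernelSharp w (n + 1)) = fun z : Circle =>
      (besovPolynomial w n fun k => fourierCoeff (onAngle φ) (-k)).eval (conj (z : ℂ)) := by
  have h : besovKernelSharp w (n + 1) = fun z : Circle => ∑ j ∈ Finset.range (2 ^ (n + 2) + 1),
      (w ((j : ℝ) / 2 ^ (n + 1)) : ℂ) * (z : ℂ) ^ (-(j : ℤ)) := by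
    funext z
    rw [besovKernelSharp, hw.besovKernel_succ, map_sum]
    refine Finset.sum_congr rfl fun j _ => ?_
    rw [map_mul, Complex.conj_ofReal, map_zpow₀, ← Circle.coe_inv_eq_conj, Circle.coe_inv,
      inv_zpow, zpow_neg]
  funext z
  rw [h, circleConv_sum_zpow hφ, eval_besovPolynomial]
  simp [← Circle.coe_inv_eq_conj]

/-! ### Summation of the blocks -/

/-- For continuous `f` the set where the essential bound fails is open and null, hence empty. -/
theorem norm_le_toReal_circleLInftyNorm {f : Circle → ℂ} (hf : Continuous f)
    (h : circleLInftyNorm f ≠ ⊤) (z : Circle) : ‖f z‖ ≤ (circleLInftyNorm f).toReal := by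
  have hc : Continuous fun t => ‖onAngle f t‖ₑ :=
    (hf.comp AddCircle.continuous_toCircle).enorm
  have hae : ∀ᵐ t ∂AddCircle.haarAddCircle, ‖onAngle f t‖ₑ ≤ circleLInftyNorm f := by
    rw [circleLInftyNorm, eLpNorm_exponent_top]
    exact enorm_ae_le_eLpNormEssSup _ _
  have hopen : IsOpen {t | ¬ ‖onAngle f t‖ₑ ≤ circleLInftyNorm f} := by
    simp only [not_le]
    exact isOpen_lt continuous_const hc
  have hempty := (hopen.measure_eq_zero_iff AddCircle.haarAddCircle).1 (ae_iff.1 hae)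
  obtain ⟨t, rfl⟩ := (AddCircle.homeomorphCircle (one_ne_zero (α := ℝ))).surjective z
  have ht : ‖onAngle f t‖ₑ ≤ circleLInftyNorm f := by
    by_contra ht
    exact (hempty ▸ ht : t ∈ (∅ : Set UnitAddCircle))
  rw [AddCircle.homeomorphCircle_apply]
  rw [← ENNReal.toReal_ofReal (norm_nonneg _), ofReal_norm]
  exact ENNReal.toReal_mono h ht

theorem hasSum_fourierCoeff_onAngle {f : ℕ → Circle → ℂ} {b : ℕ → ℝ} (hf : ∀ n, Continuous (f n))
    (hb : Summable b) (h : ∀ n z, ‖f n z‖ ≤ b n) (k : ℤ) :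
    HasSum (fun n => fourierCoeff (onAngle (f n)) k)
      (fourierCoeff (onAngle fun z => ∑' n, f n z) k) := by
  refine hasSum_integral_of_dominated_convergence (fun n _ => b n) (fun n => ?_)
    (fun n => Eventually.of_forall fun t => ?_) (Eventually.of_forall fun _ => hb)
    (integrable_const _) (Eventually.of_forall fun t => ?_)
  · exact ((map_continuous (fourier (-k))).smul
      ((hf n).comp AddCircle.continuous_toCircle)).aestronglyMeasurable
  · rw [norm_smul, fourier_apply, Circle.norm_coe, one_mul]
    exact h n _
  · exact (Summable.of_norm_bounded hb fun n => h n _).hasSum.const_smul _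

/-- Here `N = 2^(n+2)` and `M = 2^n`: one factor `N + 1 ≤ 4 (M + 1)` cancels the denominator, and
the other `m` are at most `5 * 2^(n+1)` each. -/
theorem pow_succ_div_le (m n : ℕ) :
    (((2 ^ (n + 2) : ℕ) : ℝ) + 1) ^ (m + 1) / (((2 ^ n : ℕ) : ℝ) + 1) ≤
      4 * 5 ^ m * 2 ^ ((n + 1) * m) := by
  have h2 : (1 : ℝ) ≤ 2 ^ n := one_le_pow₀ one_le_two
  rw [div_le_iff₀ (by positivity)]
  push_cast
  have h3 : (2 : ℝ) ^ (n + 2) + 1 ≤ 5 * 2 ^ (n + 1) := by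
    rw [pow_add, pow_succ _ n]; linarith
  have h4 : (2 : ℝ) ^ (n + 2) + 1 ≤ 4 * (2 ^ n + 1) := by rw [pow_add]; linarith
  calc ((2 : ℝ) ^ (n + 2) + 1) ^ (m + 1)
      = (2 ^ (n + 2) + 1) ^ m * (2 ^ (n + 2) + 1) := pow_succ _ _
    _ ≤ (5 * 2 ^ (n + 1)) ^ m * (4 * (2 ^ n + 1)) := by gcongr
    _ = 4 * 5 ^ m * 2 ^ ((n + 1) * m) * (2 ^ n + 1) := by rw [mul_pow, ← pow_mul]; ring

section

variable {w : ℝ → ℝ} {m : ℕ} {c : ℤ → ℂ} {S : ℕ → ℝ}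

theorem IsDyadicResolution.hasProjDividedDiffs_tsum (hw : IsDyadicResolution w)
    (hS : ∀ n, ∀ z : Circle, ‖(besovPolynomial w n c).eval (z : ℂ)‖ ≤ S n)
    (hsum : Summable fun n => 2 ^ ((n + 1) * m) * S n) :
    (∃ B, HasProjDividedDiffs m (fun z => ∑' n, (besovPolynomial w n c).eval (z : ℂ)) B) ∧
    ∀ k, fourierCoeff (onAngle fun z => ∑' n, (besovPolynomial w n c).eval (z : ℂ)) k =
      if 2 ≤ k then c k else 0 := by
  have h : ∀ n, ∃ B, HasProjDividedDiffs m (fun z => (besovPolynomial w n c).eval (z : ℂ)) B ∧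
      (m ≤ n → B ≤ (m + 1) * (4 * 5 ^ m) * (2 ^ ((n + 1) * m) * S n)) := fun n => by
    -- For `m ≤ n` the order of vanishing `2^n` is at least `m`; the finitely many other blocks do
    -- not affect summability.
    by_cases hn : m ≤ n
    · refine ⟨_, hasProjDividedDiffs_eval (natDegree_besovPolynomial_le w n c)
        ((pow_dvd_pow X (Nat.le_succ _)).trans (hw.X_pow_dvd_besovPolynomial n c))
        (hn.trans n.lt_two_pow_self.le) (hS n), fun _ => ?_⟩
      have hS0 : 0 ≤ S n := (norm_nonneg _).trans (hS n 1)
      rw [mul_div_assoc, mul_assoc, mul_assoc, ← mul_assoc (4 * 5 ^ m : ℝ)]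
      gcongr
      exact pow_succ_div_le m n
    · obtain ⟨B, hB⟩ := exists_hasProjDividedDiffs_eval (besovPolynomial w n c) m
      exact ⟨B, hB, fun h => absurd h hn⟩
  choose B hB hBle using h
  have hBs : Summable B := by
    refine Summable.of_norm_bounded_eventually_nat (hsum.mul_left (((m : ℝ) + 1) * (4 * 5 ^ m))) ?_
    filter_upwards [eventually_ge_atTop m] with n hn
    rw [Real.norm_of_nonneg (hB n).nonneg]
    exact hBle n hn
  refine ⟨⟨_, HasProjDividedDiffs.hasSum hB hBs fun z =>
    (Summable.of_norm_bounded hBs fun n => (hB n).norm_le z).hasSum⟩, fun k => ?_⟩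
  have h1 := hasSum_fourierCoeff_onAngle (fun n => (hB n).continuous) hBs
    (fun n => (hB n).norm_le) k
  simp only [hw.fourierCoeff_besovPolynomial] at h1
  have h2 := ((Complex.hasSum_ofReal.2 (hw.hasSum_div_two_pow k)).mul_right (c k)).unique h1
  rw [← h2]
  split_ifs <;> simp

theorem IsDyadicResolution.hasProjDividedDiffs_tsum_conj (hw : IsDyadicResolution w)
    (hS : ∀ n, ∀ z : Circle, ‖(besovPolynomial w n c).eval (z : ℂ)‖ ≤ S n)
    (hsum : Summable fun n => 2 ^ ((n + 1) * m) * S n) :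
    (∃ B, HasProjDividedDiffs m
      (fun z => ∑' n, (besovPolynomial w n c).eval (conj (z : ℂ))) B) ∧
    ∀ k, fourierCoeff (onAngle fun z => ∑' n, (besovPolynomial w n c).eval (conj (z : ℂ))) k =
      if 2 ≤ -k then c (-k) else 0 := by
  have hB : ∀ n, HasProjDividedDiffs m (fun z => (besovPolynomial w n c).eval (conj (z : ℂ)))
      ((m + 1) * (4 * 5 ^ m) * (2 ^ ((n + 1) * m) * S n)) := fun n => by
    refine (hasProjDividedDiffs_eval_conj (natDegree_besovPolynomial_le w n c)
      (hw.X_pow_dvd_besovPolynomial n c) (hS n)).mono ?_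
    have hS0 : 0 ≤ S n := (norm_nonneg _).trans (hS n 1)
    rw [mul_div_assoc, mul_assoc, mul_assoc, ← mul_assoc (4 * 5 ^ m : ℝ)]
    gcongr
    exact pow_succ_div_le m n
  have hBs := hsum.mul_left (((m : ℝ) + 1) * (4 * 5 ^ m))
  refine ⟨⟨_, HasProjDividedDiffs.hasSum hB hBs fun z =>
    (Summable.of_norm_bounded hBs fun n => (hB n).norm_le z).hasSum⟩, fun k => ?_⟩
  have h1 := hasSum_fourierCoeff_onAngle (fun n => (hB n).continuous) hBs
    (fun n => (hB n).norm_le) k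
  simp only [hw.fourierCoeff_besovPolynomial_conj] at h1
  have h2 := ((Complex.hasSum_ofReal.2 (hw.hasSum_div_two_pow (-k))).mul_right (c (-k))).unique h1
  rw [← h2]
  split_ifs <;> simp

end

theorem summable_toReal_and_norm_le {d : ℕ} {f : ℕ → Circle → ℂ} (hf : ∀ n, Continuous (f n))
    (h : ∑' n : ℕ, (2 : ℝ≥0∞) ^ ((n + 1) * d) * circleLInftyNorm (f n) < ⊤) :
    Summable (fun n => 2 ^ ((n + 1) * d) * (circleLInftyNorm (f n)).toReal) ∧
      ∀ n z, ‖f n z‖ ≤ (circleLInftyNorm (f n)).toReal := by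
  refine ⟨?_, fun n => norm_le_toReal_circleLInftyNorm (hf n) fun hn => ?_⟩
  · have := ENNReal.summable_toReal h.ne
    simpa using this
  · refine (ENNReal.ne_top_of_tsum_ne_top h.ne n) ?_
    rw [hn, ENNReal.mul_top (by simp)]

/-! ### The continuous representative -/

theorem mainTheorem7 (m : ℕ) (hm : 1 ≤ m) (w : ℝ → ℝ) (hw : IsDyadicResolution w)
    (φ : Circle → ℂ) (hφ : MemBesovInftyOne w m φ) :
    ∃ g : Circle → ℂ, Continuous g ∧
      onAngle g =ᵐ[AddCircle.haarAddCircle] onAngle φ ∧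
      MemProjTensorCircle (dividedDiff g m) := by
  set c : ℤ → ℂ := fourierCoeff (onAngle φ) with hc
  have hpos : ∑' n : ℕ, (2 : ℝ≥0∞) ^ ((n + 1) * m) *
      circleLInftyNorm (fun z => (besovPolynomial w n c).eval (z : ℂ)) < ⊤ := by
    -- The block of `W_0` is dropped; the frequencies `-1, 0, 1` are treated exactly below.
    have h := (ENNReal.tsum_comp_le_tsum_of_injective (add_left_injective 1) fun n =>
      (2 : ℝ≥0∞) ^ (n * m) * circleLInftyNorm (circleConv φ (besovKernel w n))).trans_lt
      hφ.sum_lt_top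
    simpa only [hw.circleConv_besovKernel hφ.integrable] using h
  have hneg : ∑' n : ℕ, (2 : ℝ≥0∞) ^ ((n + 1) * m) *
      circleLInftyNorm (fun z => (besovPolynomial w n fun k => c (-k)).eval (conj (z : ℂ))) < ⊤ := by
    have h := hφ.sum_sharp_lt_top
    simpa only [hw.circleConv_besovKernelSharp hφ.integrable] using h
  obtain ⟨hs1, hb1⟩ := summable_toReal_and_norm_le (fun n => by fun_prop) hpos
  obtain ⟨hs2, hb2⟩ := summable_toReal_and_norm_le (fun n => by fun_prop) hneg
  obtain ⟨⟨B1, hB1⟩, hc1⟩ := hw.hasProjDividedDiffs_tsum hb1 hs1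
  obtain ⟨⟨B2, hB2⟩, hc2⟩ := hw.hasProjDividedDiffs_tsum_conj (fun n z => by
    have := hb2 n z⁻¹
    rwa [← Circle.coe_inv_eq_conj, inv_inv] at this) hs2
  obtain ⟨B3, hB3⟩ := exists_hasProjDividedDiffs_eval (C (c 0) + C (c 1) * X) m
  have hB4 := hasProjDividedDiffs_eval_conj (p := C (c (-1)) * X) (m := m) (M := 0) (N := 1)
    (S := ‖c (-1)‖) (natDegree_C_mul_le _ _ |>.trans natDegree_X_le) (by simp) fun z => by
      rw [eval_mul, eval_C, eval_X, norm_mul, Circle.norm_coe, mul_one]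
  have hG := (hB1.add hB2).add (hB3.add hB4)
  refine ⟨_, hG.continuous, ?_, hG.memProjTensorCircle⟩
  have hint : ∀ {g : Circle → ℂ} {B : ℝ}, HasProjDividedDiffs m g B →
      Integrable (onAngle g) AddCircle.haarAddCircle := fun h =>
    (h.continuous.comp AddCircle.continuous_toCircle).integrable_haarAddCircle
  have hc3 : ∀ k, fourierCoeff (onAngle fun z =>
      (C (c 0) + C (c 1) * X).eval (z : ℂ) + (C (c (-1)) * X).eval (conj (z : ℂ))) k =
      if |k| ≤ 1 then c k else 0 := fun k => by
    have := fourierCoeff_sum_zpow {0, 1, -1} c id k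
    have h2 : (onAngle fun z =>
      (C (c 0) + C (c 1) * X).eval (z : ℂ) + (C (c (-1)) * X).eval (conj (z : ℂ))) =
      fun t => ∑ i ∈ {0, 1, -1}, c i * (AddCircle.toCircle t : ℂ) ^ id i := by
      funext t
      simp [onAngle, ← Circle.coe_inv_eq_conj, add_assoc]
    rw [h2, this]
    simp only [id, Finset.sum_ite_eq']
    refine if_congr ?_ rfl rfl
    simp only [Finset.mem_insert, Finset.mem_singleton, abs_le]
    omega
  -- The ranges `k ≥ 2`, `k ≤ -2` and `|k| ≤ 1` partition `ℤ`, so the constructed function and `φ`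
  -- have the same Fourier coefficients.
  have hzero := ae_eq_zero_of_fourierCoeff_eq_zero
    (f := onAngle _ + (-1 : ℂ) • onAngle φ) ((hint hG).add (hφ.integrable.smul (-1 : ℂ)))
    fun k => by
      have e1 := fourierCoeff.add (hint hG) (hφ.integrable.smul (-1 : ℂ))
      have e2 := fourierCoeff.add (hint (hB1.add hB2)) (hint (hB3.add hB4))
      have e3 := fourierCoeff.add (hint hB1) (hint hB2)
      have e4 := fourierCoeff.const_smul (onAngle φ) (-1 : ℂ) k
      rw [e1, Pi.add_apply, e4]
      refine (congrArg (· + (-1 : ℂ) • c k) ((congrFun e2 k).trans (congrArg₂ (· + ·)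
        (congrFun e3 k) (hc3 k)))).trans ?_
      simp only [Pi.add_apply, hc1, hc2, neg_neg]
      have e5 : (if 2 ≤ k then c k else 0) + (if 2 ≤ -k then c k else 0) +
          (if |k| ≤ 1 then c k else 0) = c k := by
        simp only [abs_le]
        split_ifs <;> first | omega | simp
      rw [e5]
      simp
  filter_upwards [hzero] with t ht
  simp only [Pi.add_apply, Pi.smul_apply, Pi.zero_apply, smul_eq_mul, neg_mul, one_mul] at ht
  exact add_neg_eq_zero.1 ht
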